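/- An orthogonal category is a pair $\overline{\mathbf C}=(\mathbf C,\perp)$ of a small category $\mathbf C$ and a set $\perp$ of pairs of morphisms of $\mathbf C$ with a common target such that (i) $f_1\perp f_2$ implies $f_2\perp f_1$, and (ii) $f_1\perp f_2$ implies $g f_1 h_1\perp g f_2 h_2$ for all composable morphisms $g,h_1,h_2$. An orthogonal functor $F:\overline{\mathbf C}\to\overline{\mathbf D}$ is a functor $F:\mathbf C\to\mathbf D$ such that $f_1\perp_{\mathbf C} f_2$ implies $F(f_1)\perp_{\mathbf D}F(f_2)$. Fix a closed symmetric monoidal category $\mathbf M$ that has all small limits and colimits, and let $\mathbf{Alg}_{\mathsf{As}}(\mathbf M)$ be the category of associative and unital algebras in $\mathbf M$. For an orthogonal category $\overline{\mathbf C}$, let $\mathbf{QFT}(\overline{\mathbf C})\subseteq \mathbf{Alg}_{\mathsf{As}}(\mathbf M)^{\mathbf C}$ be the full subcategory of all functors $\mathfrak A:\mathbf C\to\mathbf{Alg}_{\mathsf{As}}(\mathbf M)$ such that, for all $(f_1:c_1\to c)\perp(f_2:c_2\to c)$, $$\mu_c\circ(\mathfrak A(f_1)\otimes\mathfrak A(f_2))=\mu_c^{\mathrm{op}}\circ(\mathfrak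 A(f_1)\otimes\mathfrak A(f_2)):\mathfrak A(c_1)\otimes\mathfrak A(c_2)\to\mathfrak A(c),$$ where $\mu_c$ is the multiplication of $\mathfrak A(c)$ and $\mu_c^{\mathrm{op}}$ is the symmetric braiding followed by $\mu_c$. Theorem. For every orthogonal functor $F:\overline{\mathbf C}\to\overline{\mathbf D}$ there exists an adjunction $$F_!:\mathbf{QFT}(\overline{\mathbf C})\rightleftarrows\mathbf{QFT}(\overline{\mathbf D}):F^*$$ with $F_!$ left adjoint to $F^*$, where the right adjoint $F^*$ is the restriction of the pullback functor $(-)\circ F:\mathbf{Alg}_{\mathsf{As}}(\mathbf M)^{\mathbf D}\to\mathbf{Alg}_{\mathsf{As}}(\mathbf M)^{\mathbf C}$ to the full subcategories of AQFTs. -/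

import Mathlib

open CategoryTheory CategoryTheory.Limits MonoidalCategory

universe w u

/-- An orthogonality relation on a category: a set of pairs of morphisms with a common
target that is symmetric and stable under composition. An orthogonal category is a category
together with such a relation. -/
structure OrthogonalityRelation (C : Type w) [SmallCategory C] where
  /-- `rel f₁ f₂` says that the pair `(f₁, f₂)` is orthogonal. -/
  rel : ∀ {c₁ c₂ c : C}, (c₁ ⟶ c) → (c₂ ⟶ c) → Prop
  symm : ∀ {c₁ c₂ c : C} (f₁ : c₁ ⟶ c) (f₂ : c₂ ⟶ c), rel f₁ f₂ → rel f₂ f₁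
  comp_stable : ∀ {b₁ b₂ c₁ c₂ c d : C} (g : c ⟶ d) (f₁ : c₁ ⟶ c) (f₂ : c₂ ⟶ c)
    (h₁ : b₁ ⟶ c₁) (h₂ : b₂ ⟶ c₂), rel f₁ f₂ → rel (h₁ ≫ f₁ ≫ g) (h₂ ≫ f₂ ≫ g)

/-- An orthogonal functor between orthogonal categories: a functor that preserves
orthogonal pairs. -/
structure OrthogonalFunctor {C D : Type w} [SmallCategory C] [SmallCategory D]
    (RC : OrthogonalityRelation C) (RD : OrthogonalityRelation D) extends C ⥤ D where
  map_rel : ∀ {c₁ c₂ c : C} (f₁ : c₁ ⟶ c) (f₂ : c₂ ⟶ c), RC.rel f₁ f₂ →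
    RD.rel (toFunctor.map f₁) (toFunctor.map f₂)

section

variable {C D : Type w} [SmallCategory C] [SmallCategory D]
variable (M : Type u) [Category.{w} M] [MonoidalCategory M] [SymmetricCategory M]

/-- The `⊥`-commutativity property of a functor to the category of associative and unital
algebras (that is, monoid objects) in `M`: for orthogonal `f₁ : c₁ ⟶ c` and `f₂ : c₂ ⟶ c`,
the map `A f₁ ⊗ A f₂` followed by the multiplication of `A c` agrees with `A f₁ ⊗ A f₂`
followed by the opposite multiplication (braiding, then multiplication) of `A c`. -/
def IsPerpCommutative (R : OrthogonalityRelation C) : ObjectProperty (C ⥤ Mon M) :=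
  fun A => ∀ ⦃c₁ c₂ c : C⦄ (f₁ : c₁ ⟶ c) (f₂ : c₂ ⟶ c), R.rel f₁ f₂ →
    ((A.map f₁).hom ⊗ₘ (A.map f₂).hom) ≫ MonObj.mul (X := (A.obj c).X) =
      ((A.map f₁).hom ⊗ₘ (A.map f₂).hom) ≫
        (β_ (A.obj c).X (A.obj c).X).hom ≫ MonObj.mul (X := (A.obj c).X)

/-- The category of `M`-valued AQFTs on the orthogonal category `(C, R)`: the full
subcategory of the functor category on the `⊥`-commutative functors. -/
abbrev QFT (R : OrthogonalityRelation C) :=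
  (IsPerpCommutative M R).FullSubcategory

/-- The pullback functor `F^*`: the functor `(-) ∘ F` between the functor categories,
restricted to the full subcategories of AQFTs. -/
def pullbackQFT {RC : OrthogonalityRelation C} {RD : OrthogonalityRelation D}
    (F : OrthogonalFunctor RC RD) : QFT M RD ⥤ QFT M RC :=
  (IsPerpCommutative M RC).lift
    ((IsPerpCommutative M RD).ι ⋙ (Functor.whiskeringLeft C D (Mon M)).obj F.toFunctor)
    (fun A _ _ _ f₁ f₂ h =>
      A.property (F.toFunctor.map f₁) (F.toFunctor.map f₂) (F.map_rel f₁ f₂ h))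

end

/-! The left adjoint is built in one stroke, by generators and relations. For `d` in `D`, the
algebra `F_! A d` is generated by one copy of `A c` for each `u : F c ⟶ d`. The relations make each
copy an algebra morphism, make the copies natural in `c`, and make the copies at `v₁ ⊥ v₂` commute.
Algebra maps `F_! A d ⟶ B` are thus the `Family`s with values in `B`.

If `B` is a `⊥`-commutative functor on `D`, maps `F_! A ⟶ B` correspond to maps `A ⟶ F ⋙ B`, as in
Yoneda: naturality determines the component at `u` from the one at the identity
(`extensionHomEquiv`).

That `F_! A` is itself `⊥`-commutative is checked on generators, where stability of `⊥` under
composition suffices. Generators suffice because commuting with a fixed morphism is inherited by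
products (`free_left`) and by quotients (`of_epi_left`).

Free algebras and quotients by two-sided ideals exist in `M` because closedness and the braiding
make the tensor product preserve coproducts and coequalizers in each variable. -/

open scoped MonObj

noncomputable section

/-! ### Tensor products with coproducts, coequalizers and epimorphisms. -/

section ClosedTensor

variable {M : Type u} [Category.{w} M] [MonoidalCategory M] [MonoidalClosed M]

theorem whiskerLeft_sigma_hom_ext {J : Type*} {f : J → M} [HasCoproduct f] {X Y : M}
    {h h' : X ⊗ ∐ f ⟶ Y} (H : ∀ j, X ◁ Sigma.ι f j ≫ h = X ◁ Sigma.ι f j ≫ h') : h = h' := by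
  apply MonoidalClosed.curry_injective
  refine Sigma.hom_ext _ _ fun j => ?_
  rw [← MonoidalClosed.curry_natural_left, H, MonoidalClosed.curry_natural_left]

/-- A morphism out of `X ⊗ ∐ f` from its components. -/
def whiskerLeftSigmaDesc {J : Type*} {f : J → M} [HasCoproduct f] {X Y : M}
    (h : ∀ j, X ⊗ f j ⟶ Y) : X ⊗ ∐ f ⟶ Y :=
  MonoidalClosed.uncurry (Sigma.desc fun j => MonoidalClosed.curry (h j))

@[simp]
theorem whiskerLeft_ι_sigmaDesc {J : Type*} {f : J → M} [HasCoproduct f] {X Y : M}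
    (h : ∀ j, X ⊗ f j ⟶ Y) (j : J) : X ◁ Sigma.ι f j ≫ whiskerLeftSigmaDesc h = h j := by
  simp [whiskerLeftSigmaDesc, ← MonoidalClosed.uncurry_natural_left]

instance epi_whiskerLeft_of_closed {X Y : M} (Z : M) (f : X ⟶ Y) [Epi f] : Epi (Z ◁ f) where
  left_cancellation g h H := by
    apply MonoidalClosed.curry_injective
    rw [← cancel_epi f, ← MonoidalClosed.curry_natural_left, H,
      MonoidalClosed.curry_natural_left]

/-- A morphism out of `X ⊗ coequalizer f g`. -/
def whiskerLeftCoequalizerDesc {R A : M} {f g : R ⟶ A} [HasCoequalizer f g] {X Y : M}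
    (h : X ⊗ A ⟶ Y) (w : X ◁ f ≫ h = X ◁ g ≫ h) : X ⊗ coequalizer f g ⟶ Y :=
  MonoidalClosed.uncurry (coequalizer.desc (MonoidalClosed.curry h) (by
    rw [← MonoidalClosed.curry_natural_left, w, MonoidalClosed.curry_natural_left]))

@[simp]
theorem whiskerLeft_π_coequalizerDesc {R A : M} {f g : R ⟶ A} [HasCoequalizer f g] {X Y : M}
    (h : X ⊗ A ⟶ Y) (w : X ◁ f ≫ h = X ◁ g ≫ h) :
    X ◁ coequalizer.π f g ≫ whiskerLeftCoequalizerDesc h w = h := by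
  simp [whiskerLeftCoequalizerDesc, ← MonoidalClosed.uncurry_natural_left]

variable [BraidedCategory M]

instance epi_whiskerRight_of_closed {X Y : M} (f : X ⟶ Y) (Z : M) [Epi f] : Epi (f ▷ Z) := by
  have h : f ▷ Z = (β_ X Z).hom ≫ Z ◁ f ≫ (β_ Y Z).inv := by
    rw [← BraidedCategory.braiding_naturality_left_assoc]; simp
  rw [h]
  infer_instance

instance epi_tensorHom_of_closed {X Y X' Y' : M} (f : X ⟶ Y) (g : X' ⟶ Y') [Epi f] [Epi g] :
    Epi (f ⊗ₘ g) := by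
  rw [MonoidalCategory.tensorHom_def]
  infer_instance

theorem whiskerRight_sigma_hom_ext {J : Type*} {f : J → M} [HasCoproduct f] {Z Y : M}
    {h h' : (∐ f) ⊗ Z ⟶ Y} (H : ∀ j, Sigma.ι f j ▷ Z ≫ h = Sigma.ι f j ▷ Z ≫ h') : h = h' := by
  rw [← cancel_epi (β_ Z (∐ f)).hom]
  refine whiskerLeft_sigma_hom_ext fun j => ?_
  rw [BraidedCategory.braiding_naturality_right_assoc, H,
    BraidedCategory.braiding_naturality_right_assoc]

/-- A morphism out of `(∐ f) ⊗ Z` from its components. -/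
def whiskerRightSigmaDesc {J : Type*} {f : J → M} [HasCoproduct f] {Z Y : M}
    (h : ∀ j, f j ⊗ Z ⟶ Y) : (∐ f) ⊗ Z ⟶ Y :=
  (β_ _ _).hom ≫ whiskerLeftSigmaDesc fun j => (β_ _ _).inv ≫ h j

@[simp]
theorem whiskerRight_ι_sigmaDesc {J : Type*} {f : J → M} [HasCoproduct f] {Z Y : M}
    (h : ∀ j, f j ⊗ Z ⟶ Y) (j : J) : Sigma.ι f j ▷ Z ≫ whiskerRightSigmaDesc h = h j := by
  simp [whiskerRightSigmaDesc, BraidedCategory.braiding_naturality_left_assoc]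

/-- A morphism out of `coequalizer f g ⊗ Z`. -/
def whiskerRightCoequalizerDesc {R A : M} {f g : R ⟶ A} [HasCoequalizer f g] {Z Y : M}
    (h : A ⊗ Z ⟶ Y) (w : f ▷ Z ≫ h = g ▷ Z ≫ h) : coequalizer f g ⊗ Z ⟶ Y :=
  (β_ _ _).hom ≫ whiskerLeftCoequalizerDesc ((β_ _ _).inv ≫ h) (by
    simp [BraidedCategory.braiding_inv_naturality_right_assoc, w])

@[simp]
theorem whiskerRight_π_coequalizerDesc {R A : M} {f g : R ⟶ A} [HasCoequalizer f g] {Z Y : M}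
    (h : A ⊗ Z ⟶ Y) (w : f ▷ Z ≫ h = g ▷ Z ≫ h) :
    coequalizer.π f g ▷ Z ≫ whiskerRightCoequalizerDesc h w = h := by
  simp [whiskerRightCoequalizerDesc, BraidedCategory.braiding_naturality_left_assoc]

end ClosedTensor

namespace MonObj

variable {M : Type u} [Category.{w} M] [MonoidalCategory M]

theorem tensorHom_mul_assoc {B X Y Z : M} [MonObj B] (f : X ⟶ B) (g : Y ⟶ B) (h : Z ⟶ B) :
    ((f ⊗ₘ g) ≫ μ[B] ⊗ₘ h) ≫ μ[B] = (α_ X Y Z).hom ≫ (f ⊗ₘ (g ⊗ₘ h) ≫ μ[B]) ≫ μ[B] := by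
  have e₁ : f ⊗ₘ (g ⊗ₘ h) ≫ μ[B] = (f ⊗ₘ (g ⊗ₘ h)) ≫ B ◁ μ[B] := by
    rw [← id_tensorHom, tensorHom_comp_tensorHom, Category.comp_id]
  have e₂ : (f ⊗ₘ g) ≫ μ[B] ⊗ₘ h = ((f ⊗ₘ g) ⊗ₘ h) ≫ μ[B] ▷ B := by
    rw [← tensorHom_id, tensorHom_comp_tensorHom, Category.comp_id]
  rw [e₁, e₂, Category.assoc, Category.assoc, MonObj.mul_assoc, associator_naturality_assoc]

/-- Puts `(f g) h` into the recursive form that `fold_ext` asks for. -/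
theorem tensorHom_mul_tensorHom_mul {B X Y Z : M} [MonObj B] (f : X ⟶ B) (g : Y ⟶ B)
    (h : Z ⟶ B) : ((f ⊗ₘ g) ≫ μ[B] ⊗ₘ h) ≫ μ[B] =
      (α_ X Y Z).hom ≫ X ◁ ((g ⊗ₘ h) ≫ μ[B]) ≫ f ▷ B ≫ μ[B] := by
  rw [tensorHom_mul_assoc, MonoidalCategory.tensorHom_def' f, Category.assoc]

end MonObj

/-! ### Free monoid objects as objects of words. -/

namespace FreeMonObj

variable {M : Type u} [Category.{w} M] [MonoidalCategory M] [BraidedCategory M]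
  [MonoidalClosed M] [HasColimits M]

/-- Iterated tensor powers of an object. -/
def pow (X : M) : ℕ → M
  | 0 => 𝟙_ M
  | n + 1 => X ⊗ pow X n

/-- The object underlying the free monoid object on `X`. -/
def carrier (X : M) : M := ∐ pow X

/-- The inclusion of the words of length `n`. -/
def incl (X : M) (n : ℕ) : pow X n ⟶ carrier X := Sigma.ι (pow X) n

/-- The inclusion of the words of length `n + 1`. -/
def inclSucc (X : M) (n : ℕ) : X ⊗ pow X n ⟶ carrier X := Sigma.ι (pow X) (n + 1)

/-- The empty word. -/
def nil (X : M) : 𝟙_ M ⟶ carrier X := Sigma.ι (pow X) 0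

/-- Prepending a letter to a word. -/
def cons (X : M) : X ⊗ carrier X ⟶ carrier X :=
  whiskerLeftSigmaDesc (inclSucc X)

omit [BraidedCategory M] in
theorem whiskerLeft_incl_cons (X : M) (n : ℕ) : X ◁ incl X n ≫ cons X = inclSucc X n :=
  whiskerLeft_ι_sigmaDesc _ _

variable {X Y Z : M}

/-- The restriction of `fold` to words of a fixed length. -/
def foldPow (z : Z ⟶ Y) (s : X ⊗ Y ⟶ Y) : ∀ n, pow X n ⊗ Z ⟶ Y
  | 0 => (λ_ Z).hom ≫ z
  | n + 1 => (α_ X (pow X n) Z).hom ≫ X ◁ foldPow z s n ≫ s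

/-- Parametrized recursion on words. -/
def fold (z : Z ⟶ Y) (s : X ⊗ Y ⟶ Y) : carrier X ⊗ Z ⟶ Y :=
  whiskerRightSigmaDesc (foldPow z s)

@[simp]
theorem nil_fold (z : Z ⟶ Y) (s : X ⊗ Y ⟶ Y) : nil X ▷ Z ≫ fold z s = (λ_ Z).hom ≫ z :=
  whiskerRight_ι_sigmaDesc _ _

theorem incl_fold (z : Z ⟶ Y) (s : X ⊗ Y ⟶ Y) (n : ℕ) :
    incl X n ▷ Z ≫ fold z s = foldPow z s n :=
  whiskerRight_ι_sigmaDesc _ _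

theorem inclSucc_fold (z : Z ⟶ Y) (s : X ⊗ Y ⟶ Y) (n : ℕ) :
    inclSucc X n ▷ Z ≫ fold z s = (α_ X (pow X n) Z).hom ≫ X ◁ foldPow z s n ≫ s :=
  whiskerRight_ι_sigmaDesc _ _

omit [BraidedCategory M] in
theorem whiskerLeft_hom_ext {W : M} {h h' : W ⊗ carrier X ⟶ Y}
    (H : ∀ n, W ◁ incl X n ≫ h = W ◁ incl X n ≫ h') : h = h' :=
  whiskerLeft_sigma_hom_ext H

/-- The braiding moves the coproduct from the middle to the right end, where closedness applies. -/
theorem whiskerLeft_whiskerRight_hom_ext {W : M} {h h' : (W ⊗ carrier X) ⊗ Z ⟶ Y}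
    (H : ∀ n, (W ◁ incl X n) ▷ Z ≫ h = (W ◁ incl X n) ▷ Z ≫ h') : h = h' := by
  rw [← cancel_epi (α_ W (carrier X) Z).inv, ← cancel_epi (W ◁ (β_ Z (carrier X)).hom),
    ← cancel_epi (α_ W Z (carrier X)).hom]
  refine whiskerLeft_hom_ext fun n => ?_
  have e : ∀ k : (W ⊗ carrier X) ⊗ Z ⟶ Y, (W ⊗ Z) ◁ incl X n ≫
      (α_ W Z (carrier X)).hom ≫ W ◁ (β_ Z (carrier X)).hom ≫ (α_ W (carrier X) Z).inv ≫ k =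
      (α_ W Z _).hom ≫ W ◁ (β_ Z _).hom ≫ (α_ W _ Z).inv ≫ (W ◁ incl X n) ▷ Z ≫ k := by
    intro k
    rw [associator_naturality_right_assoc, ← whiskerLeft_comp_assoc,
      BraidedCategory.braiding_naturality_right, whiskerLeft_comp_assoc,
      associator_inv_naturality_middle_assoc]
  rw [e h, e h', H]

@[simp]
theorem cons_fold (z : Z ⟶ Y) (s : X ⊗ Y ⟶ Y) :
    cons X ▷ Z ≫ fold z s = (α_ X (carrier X) Z).hom ≫ X ◁ fold z s ≫ s := by
  refine whiskerLeft_whiskerRight_hom_ext fun n => ?_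
  rw [← comp_whiskerRight_assoc, whiskerLeft_incl_cons, inclSucc_fold,
    associator_naturality_middle_assoc, ← whiskerLeft_comp_assoc, incl_fold]

/-- Uniqueness of parametrized recursion. -/
theorem fold_ext {h h' : carrier X ⊗ Z ⟶ Y} (s : X ⊗ Y ⟶ Y)
    (h_nil : nil X ▷ Z ≫ h = nil X ▷ Z ≫ h')
    (h_cons : cons X ▷ Z ≫ h = (α_ X (carrier X) Z).hom ≫ X ◁ h ≫ s)
    (h_cons' : cons X ▷ Z ≫ h' = (α_ X (carrier X) Z).hom ≫ X ◁ h' ≫ s) : h = h' := by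
  suffices H : ∀ n, incl X n ▷ Z ≫ h = incl X n ▷ Z ≫ h' from whiskerRight_sigma_hom_ext H
  intro n
  induction n with
  | zero => exact h_nil
  | succ n ih =>
    change inclSucc X n ▷ Z ≫ h = inclSucc X n ▷ Z ≫ h'
    simp only [← whiskerLeft_incl_cons, comp_whiskerRight_assoc, h_cons, h_cons',
      associator_naturality_middle_assoc, ← whiskerLeft_comp_assoc, ih]

omit [BraidedCategory M] in
/-- Uniqueness of recursion. -/
theorem hom_ext {h h' : carrier X ⟶ Y} (s : X ⊗ Y ⟶ Y) (h_nil : nil X ≫ h = nil X ≫ h')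
    (h_cons : cons X ≫ h = X ◁ h ≫ s) (h_cons' : cons X ≫ h' = X ◁ h' ≫ s) : h = h' := by
  suffices H : ∀ n, incl X n ≫ h = incl X n ≫ h' from Sigma.hom_ext _ _ H
  intro n
  induction n with
  | zero => exact h_nil
  | succ n ih =>
    change inclSucc X n ≫ h = inclSucc X n ≫ h'
    simp only [← whiskerLeft_incl_cons, Category.assoc, h_cons, h_cons',
      ← whiskerLeft_comp_assoc, ih]

/-- Concatenation of words. -/
def append (X : M) : carrier X ⊗ carrier X ⟶ carrier X := fold (𝟙 _) (cons X)

@[simp]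
theorem nil_append : nil X ▷ carrier X ≫ append X = (λ_ _).hom := by
  simp [append]

@[simp]
theorem cons_append : cons X ▷ carrier X ≫ append X =
    (α_ X (carrier X) (carrier X)).hom ≫ X ◁ append X ≫ cons X :=
  cons_fold _ _

/-- The right unit law and associativity are inductions on the first word, with parameter object the
unit and `carrier X ⊗ carrier X` respectively. -/
instance (X : M) : MonObj (carrier X) where
  one := nil X
  mul := append X
  one_mul := nil_append
  mul_one := by
    refine fold_ext (cons X) ?_ ?_ ?_
    · rw [← whisker_exchange_assoc, nil_append, leftUnitor_naturality, rightUnitor_naturality,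
        unitors_equal]
    · rw [← whisker_exchange_assoc, cons_append, associator_naturality_right_assoc,
        whiskerLeft_comp_assoc]
    · rw [rightUnitor_naturality]
      simp
  mul_assoc := by
    rw [← cancel_epi (α_ (carrier X) (carrier X) (carrier X)).inv, Iso.inv_hom_id_assoc]
    refine fold_ext (cons X) ?_ ?_ ?_
    · rw [associator_inv_naturality_left_assoc, ← comp_whiskerRight_assoc, nil_append,
        ← whisker_exchange_assoc, nil_append]
      simp
    · rw [associator_inv_naturality_left_assoc, ← comp_whiskerRight_assoc, cons_append]
      simp
    · rw [← whisker_exchange_assoc, cons_append]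
      simp

theorem one_eq_nil (X : M) : η[carrier X] = nil X := rfl

theorem mul_eq_append (X : M) : μ[carrier X] = append X := rfl

/-- The inclusion of the letters. -/
def of (X : M) : X ⟶ carrier X := (ρ_ X).inv ≫ X ◁ nil X ≫ cons X

theorem of_mul (X : M) : of X ▷ carrier X ≫ μ[carrier X] = cons X := by
  rw [mul_eq_append]
  simp only [of, comp_whiskerRight, Category.assoc, cons_append, associator_naturality_middle_assoc]
  rw [← whiskerLeft_comp_assoc, nil_append]
  simp

variable {B : M} [MonObj B]

/-- The morphism of monoid objects extending a morphism on letters. -/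
def lift (f : X ⟶ B) : carrier X ⟶ B := (ρ_ _).inv ≫ fold η[B] (f ▷ B ≫ μ[B])

@[simp]
theorem nil_lift (f : X ⟶ B) : nil X ≫ lift f = η[B] := by
  rw [lift, rightUnitor_inv_naturality_assoc, nil_fold, unitors_equal, Iso.inv_hom_id_assoc]

theorem cons_lift (f : X ⟶ B) : cons X ≫ lift f = X ◁ lift f ≫ f ▷ B ≫ μ[B] := by
  rw [lift, rightUnitor_inv_naturality_assoc, cons_fold]
  simp

@[simp]
theorem of_lift (f : X ⟶ B) : of X ≫ lift f = f := by
  simp only [of, Category.assoc, cons_lift, ← whiskerLeft_comp_assoc, nil_lift]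
  rw [whisker_exchange_assoc, MonObj.mul_one, rightUnitor_naturality, Iso.inv_hom_id_assoc]

instance (f : X ⟶ B) : IsMonHom (lift f) where
  one_hom := nil_lift f
  mul_hom := by
    rw [mul_eq_append]
    refine fold_ext (f ▷ B ≫ μ[B]) ?_ ?_ ?_
    · rw [reassoc_of% nil_append, MonoidalCategory.tensorHom_def, Category.assoc,
        ← comp_whiskerRight_assoc, nil_lift, ← whisker_exchange_assoc, MonObj.one_mul]
      simp
    · simp [reassoc_of% cons_append, cons_lift]
    · have e : cons X ▷ carrier X ≫ (lift f ⊗ₘ lift f) = (f ⊗ₘ lift f) ≫ μ[B] ⊗ₘ lift f := by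
        rw [← tensorHom_id, tensorHom_comp_tensorHom, Category.id_comp, cons_lift,
          MonoidalCategory.tensorHom_def' f, Category.assoc]
      rw [reassoc_of% e, MonObj.tensorHom_mul_tensorHom_mul]

/-- Prepending is multiplication by a letter, so a monoid morphism satisfies a recursion whose step
depends only on its values on letters. -/
theorem cons_comp_of_isMonHom (h : carrier X ⟶ B) [IsMonHom h] :
    cons X ≫ h = X ◁ h ≫ (of X ≫ h) ▷ B ≫ μ[B] := by
  rw [← of_mul, Category.assoc, IsMonHom.mul_hom, MonoidalCategory.tensorHom_def',
    Category.assoc, ← whisker_exchange_assoc]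
  simp

theorem monHom_ext {h h' : carrier X ⟶ B} [IsMonHom h] [IsMonHom h']
    (H : of X ≫ h = of X ≫ h') : h = h' := by
  refine hom_ext ((of X ≫ h) ▷ B ≫ μ[B]) ?_ (cons_comp_of_isMonHom h)
    (by rw [cons_comp_of_isMonHom h', H])
  rw [← one_eq_nil, IsMonHom.one_hom, IsMonHom.one_hom]

end FreeMonObj

/-! ### Commuting morphisms into a monoid object. -/

namespace MonObj

variable {M : Type u} [Category.{w} M] [MonoidalCategory M] [BraidedCategory M]

/-- Two morphisms into a monoid object commute if the product of their values does not depend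
on the order. -/
def Commute {B X Y : M} [MonObj B] (f : X ⟶ B) (g : Y ⟶ B) : Prop :=
  (f ⊗ₘ g) ≫ μ[B] = (f ⊗ₘ g) ≫ (β_ B B).hom ≫ μ[B]

namespace Commute

variable {B X Y : M} [MonObj B]

/-- With the braiding moved to the sources, induction on a word in `X` becomes possible. -/
theorem iff_swap {f : X ⟶ B} {g : Y ⟶ B} :
    Commute f g ↔ (f ⊗ₘ g) ≫ μ[B] = (β_ X Y).hom ≫ (g ⊗ₘ f) ≫ μ[B] := by
  rw [Commute, BraidedCategory.braiding_naturality_assoc]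

theorem comp_left {X' : M} {f : X ⟶ B} {g : Y ⟶ B} (h : Commute f g) (k : X' ⟶ X) :
    Commute (k ≫ f) g := by
  have e : (k ≫ f) ⊗ₘ g = k ▷ Y ≫ (f ⊗ₘ g) := by simp [MonoidalCategory.tensorHom_def]
  simp only [Commute, e, Category.assoc]
  rw [h]

end Commute

end MonObj

namespace MonObj.Commute

variable {M : Type u} [Category.{w} M] [MonoidalCategory M] [SymmetricCategory M]
variable {B X Y : M} [MonObj B]

theorem symm {f : X ⟶ B} {g : Y ⟶ B} (h : Commute f g) : Commute g f := by
  rw [iff_swap] at h ⊢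
  rw [h, SymmetricCategory.symmetry_assoc]

variable [MonoidalClosed M]

theorem of_epi_left {X' : M} (k : X' ⟶ X) [Epi k] {f : X ⟶ B} {g : Y ⟶ B}
    (h : Commute (k ≫ f) g) : Commute f g := by
  have e : (k ≫ f) ⊗ₘ g = k ▷ Y ≫ (f ⊗ₘ g) := by simp [MonoidalCategory.tensorHom_def]
  simpa only [Commute, e, Category.assoc, cancel_epi] using h

theorem sigma_left {J : Type*} {X : J → M} [HasCoproduct X] {f : ∐ X ⟶ B} {g : Y ⟶ B}
    (h : ∀ j, Commute (Sigma.ι X j ≫ f) g) : Commute f g := by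
  refine whiskerRight_sigma_hom_ext fun j => ?_
  have e : (Sigma.ι X j ≫ f) ⊗ₘ g = Sigma.ι X j ▷ Y ≫ (f ⊗ₘ g) := by
    simp [MonoidalCategory.tensorHom_def]
  simpa only [Commute, e, Category.assoc] using h j

variable [HasColimits M]

open FreeMonObj in
-- Induction on the word: if a letter `x` and a word `w` both commute with `g`, then `g (x w) = (g
-- x) w = (x g) w = x (g w) = (x w) g`.
theorem free_left {f : carrier X ⟶ B} [IsMonHom f] {g : Y ⟶ B} (h : Commute (of X ≫ f) g) :
    Commute f g := by
  rw [iff_swap] at h ⊢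
  refine fold_ext ((of X ≫ f) ▷ B ≫ μ[B]) ?_ ?_ ?_
  · have e : nil X ≫ f = η[B] := by rw [← one_eq_nil, IsMonHom.one_hom]
    rw [BraidedCategory.braiding_naturality_left_assoc,
      MonoidalCategory.tensorHom_def f g, MonoidalCategory.tensorHom_def' g f,
      Category.assoc, Category.assoc, ← comp_whiskerRight_assoc, ← whiskerLeft_comp_assoc, e,
      ← whisker_exchange_assoc, MonObj.one_mul,
      whisker_exchange_assoc, MonObj.mul_one]
    simp
  · have e : cons X ▷ Y ≫ (f ⊗ₘ g) = ((of X ≫ f) ⊗ₘ f) ≫ μ[B] ⊗ₘ g := by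
      rw [← tensorHom_id, tensorHom_comp_tensorHom, Category.id_comp, cons_comp_of_isMonHom,
        MonoidalCategory.tensorHom_def' (of X ≫ f), Category.assoc]
    rw [reassoc_of% e, MonObj.tensorHom_mul_tensorHom_mul]
  -- The hypothesis read in the other direction; here the braiding must be symmetric.
  · have hc : (g ⊗ₘ (of X ≫ f)) ≫ μ[B] = (β_ Y X).hom ≫ ((of X ≫ f) ⊗ₘ g) ≫ μ[B] := by
      rw [h, SymmetricCategory.symmetry_assoc]
    have hl : cons X ▷ Y ≫ (β_ (carrier X) Y).hom ≫ (g ⊗ₘ f) ≫ μ[B] =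
        (β_ (X ⊗ carrier X) Y).hom ≫ (α_ Y X (carrier X)).inv ≫
          ((g ⊗ₘ (of X ≫ f)) ≫ μ[B] ⊗ₘ f) ≫ μ[B] := by
      have e : Y ◁ cons X ≫ (g ⊗ₘ f) = g ⊗ₘ ((of X ≫ f) ⊗ₘ f) ≫ μ[B] := by
        rw [MonoidalCategory.tensorHom_def', ← whiskerLeft_comp_assoc, cons_comp_of_isMonHom,
          ← MonoidalCategory.tensorHom_def', MonoidalCategory.tensorHom_def' (of X ≫ f),
          Category.assoc]
      rw [BraidedCategory.braiding_naturality_left_assoc, tensorHom_mul_assoc,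
        Iso.inv_hom_id_assoc, reassoc_of% e]
    have hr : X ◁ ((β_ (carrier X) Y).hom ≫ (g ⊗ₘ f) ≫ μ[B]) ≫ (of X ≫ f) ▷ B ≫ μ[B] =
        X ◁ (β_ (carrier X) Y).hom ≫ (α_ X Y (carrier X)).inv ≫
          (((of X ≫ f) ⊗ₘ g) ≫ μ[B] ⊗ₘ f) ≫ μ[B] := by
      rw [tensorHom_mul_assoc, Iso.inv_hom_id_assoc, whiskerLeft_comp_assoc,
        ← MonoidalCategory.tensorHom_def'_assoc]
    -- The hexagon splits the braiding of `Y` past `x w` into braidings past `w` and past `x`.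
    rw [hl, hr, hc, BraidedCategory.braiding_tensor_left_hom]
    simp only [Category.assoc, Iso.hom_inv_id_assoc]
    have e : (β_ X Y).hom ▷ carrier X ≫ ((β_ Y X).hom ≫ ((of X ≫ f) ⊗ₘ g) ≫ μ[B] ⊗ₘ f) =
        ((of X ≫ f) ⊗ₘ g) ≫ μ[B] ⊗ₘ f := by
      rw [← tensorHom_id, tensorHom_comp_tensorHom, SymmetricCategory.symmetry_assoc,
        Category.id_comp]
    rw [reassoc_of% e]

end MonObj.Commute

/-! ### Quotients of monoid objects by two-sided ideals. -/

namespace QuotientMonObj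

section

variable {M : Type u} [Category.{w} M] [MonoidalCategory M] {A R : M} [MonObj A]

/-- The morphism `a ⊗ r ⊗ b ↦ a * f r * b`. -/
def sandwich (f : R ⟶ A) : (A ⊗ R) ⊗ A ⟶ A := (A ◁ f ≫ μ[A]) ▷ A ≫ μ[A]

/-- Since `1 * f r * 1 = f r`, coequalizing the sandwiches identifies the original pair as well. -/
theorem unit_sandwich (f : R ⟶ A) :
    (λ_ R).inv ≫ (ρ_ _).inv ≫ η[A] ▷ R ▷ 𝟙_ M ≫ (A ⊗ R) ◁ η[A] ≫ sandwich f = f := by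
  rw [sandwich, whisker_exchange_assoc, MonObj.mul_one, ← comp_whiskerRight_assoc,
    ← whisker_exchange_assoc, MonObj.one_mul, rightUnitor_naturality]
  simp

/-- A left factor is absorbed by a map independent of `f`; this lets left multiplication descend to
the quotient. -/
theorem whiskerLeft_sandwich_mul (f : R ⟶ A) :
    A ◁ sandwich f ≫ μ[A] =
      (α_ A (A ⊗ R) A).inv ≫ (α_ A A R).inv ▷ A ≫ μ[A] ▷ R ▷ A ≫ sandwich f := by
  have e : A ◁ (A ◁ f ≫ μ[A]) ≫ μ[A] = (α_ A A R).inv ≫ μ[A] ▷ R ≫ A ◁ f ≫ μ[A] := by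
    rw [MonoidalCategory.whiskerLeft_comp, Category.assoc, MonObj.mul_assoc_flip,
      associator_inv_naturality_right_assoc, whisker_exchange_assoc]
  rw [sandwich, MonoidalCategory.whiskerLeft_comp, Category.assoc, MonObj.mul_assoc_flip,
    associator_inv_naturality_middle_assoc, ← comp_whiskerRight_assoc, e]
  simp only [comp_whiskerRight, Category.assoc]

theorem sandwich_whiskerRight_mul (f : R ⟶ A) :
    sandwich f ▷ A ≫ μ[A] = (α_ (A ⊗ R) A A).hom ≫ (A ⊗ R) ◁ μ[A] ≫ sandwich f := by
  rw [sandwich, comp_whiskerRight, Category.assoc, MonObj.mul_assoc,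
    associator_naturality_left_assoc, ← whisker_exchange_assoc]

/-- The right-hand side sees `f` only through `f ≫ h`, so a monoid morphism equalizing `f` and `g`
also equalizes their sandwiches. -/
theorem sandwich_comp {B : M} [MonObj B] (f : R ⟶ A) (h : A ⟶ B) [IsMonHom h] :
    sandwich f ≫ h = (h ▷ R) ▷ A ≫ (B ⊗ R) ◁ h ≫ sandwich (f ≫ h) := by
  have e : (A ◁ f ≫ μ[A]) ≫ h = h ▷ R ≫ B ◁ (f ≫ h) ≫ μ[B] := by
    rw [Category.assoc, IsMonHom.mul_hom, MonoidalCategory.tensorHom_def',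
      MonoidalCategory.whiskerLeft_comp, Category.assoc, Category.assoc, ← whisker_exchange_assoc,
      ← whisker_exchange_assoc]
  rw [sandwich, Category.assoc, IsMonHom.mul_hom, MonoidalCategory.tensorHom_def, Category.assoc,
    ← comp_whiskerRight_assoc, e, comp_whiskerRight_assoc, sandwich, whisker_exchange_assoc]

end

variable {M : Type u} [Category.{w} M] [MonoidalCategory M] [BraidedCategory M]
  [MonoidalClosed M] [HasColimits M] {A R : M} [MonObj A] (f g : R ⟶ A)

/-- The object underlying the quotient of `A` by the two-sided ideal generated by `f = g`. -/
def carrier : M := coequalizer (sandwich f) (sandwich g)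

/-- The quotient morphism. -/
def π : A ⟶ carrier f g := coequalizer.π _ _

instance : Epi (π f g) := inferInstanceAs (Epi (coequalizer.π _ _))

omit [BraidedCategory M] [MonoidalClosed M] in
theorem sandwich_π : sandwich f ≫ π f g = sandwich g ≫ π f g := coequalizer.condition _ _

omit [BraidedCategory M] [MonoidalClosed M] in
theorem condition : f ≫ π f g = g ≫ π f g := by
  have e : ∀ k : R ⟶ A, k ≫ π f g = (λ_ R).inv ≫ (ρ_ _).inv ≫ η[A] ▷ R ▷ 𝟙_ M ≫
      (A ⊗ R) ◁ η[A] ≫ sandwich k ≫ π f g := fun k => by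
    conv_lhs => rw [← unit_sandwich k]
    simp only [Category.assoc]
  rw [e f, e g, sandwich_π]

/-- The left action of `A` on the quotient. -/
def act : A ⊗ carrier f g ⟶ carrier f g :=
  whiskerLeftCoequalizerDesc (μ[A] ≫ π f g) (by
    rw [← Category.assoc, ← Category.assoc, whiskerLeft_sandwich_mul, whiskerLeft_sandwich_mul]
    simp only [Category.assoc, sandwich_π f g])

omit [BraidedCategory M] in
theorem π_act : A ◁ π f g ≫ act f g = μ[A] ≫ π f g := whiskerLeft_π_coequalizerDesc _ _

/-- The multiplication of the quotient. -/
def mul : carrier f g ⊗ carrier f g ⟶ carrier f g :=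
  whiskerRightCoequalizerDesc (act f g) (by
    rw [← cancel_epi (_ ◁ π f g), whisker_exchange_assoc, whisker_exchange_assoc, π_act,
      ← Category.assoc, ← Category.assoc, sandwich_whiskerRight_mul, sandwich_whiskerRight_mul]
    simp only [Category.assoc, sandwich_π f g])

theorem π_whiskerRight_mul : π f g ▷ carrier f g ≫ mul f g = act f g :=
  whiskerRight_π_coequalizerDesc _ _

theorem π_tensorHom_π_mul : (π f g ⊗ₘ π f g) ≫ mul f g = μ[A] ≫ π f g := by
  rw [MonoidalCategory.tensorHom_def', Category.assoc, π_whiskerRight_mul, π_act]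

/-- The laws are inherited from `A`: tensor products of `π` with itself and with identities are
epimorphisms. -/
instance : MonObj (carrier f g) where
  one := η[A] ≫ π f g
  mul := mul f g
  one_mul := by
    rw [← cancel_epi (𝟙_ M ◁ π f g), comp_whiskerRight_assoc, π_whiskerRight_mul,
      whisker_exchange_assoc, π_act, MonObj.one_mul_assoc, leftUnitor_naturality]
  mul_one := by
    rw [← cancel_epi (π f g ▷ 𝟙_ M), ← whisker_exchange_assoc, π_whiskerRight_mul,
      whiskerLeft_comp_assoc, π_act, MonObj.mul_one_assoc, rightUnitor_naturality]
  mul_assoc := by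
    rw [← cancel_epi ((π f g ⊗ₘ π f g) ⊗ₘ π f g)]
    rw [associator_naturality_assoc]
    have e₁ : ((π f g ⊗ₘ π f g) ⊗ₘ π f g) ≫ mul f g ▷ carrier f g =
        μ[A] ▷ A ≫ (π f g ⊗ₘ π f g) := by
      rw [← tensorHom_id, tensorHom_comp_tensorHom, ← tensorHom_id, tensorHom_comp_tensorHom,
        Category.comp_id, Category.id_comp, π_tensorHom_π_mul]
    have e₂ : (π f g ⊗ₘ (π f g ⊗ₘ π f g)) ≫ carrier f g ◁ mul f g =
        A ◁ μ[A] ≫ (π f g ⊗ₘ π f g) := by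
      rw [← id_tensorHom, tensorHom_comp_tensorHom, ← id_tensorHom, tensorHom_comp_tensorHom,
        Category.comp_id, Category.id_comp, π_tensorHom_π_mul]
    rw [reassoc_of% e₁, reassoc_of% e₂, π_tensorHom_π_mul, MonObj.mul_assoc_assoc]

instance : IsMonHom (π f g) where
  one_hom := rfl
  mul_hom := (π_tensorHom_π_mul f g).symm

variable {f g} {B : M} [MonObj B]

/-- The universal property of the quotient. -/
def desc (h : A ⟶ B) [IsMonHom h] (w : f ≫ h = g ≫ h) : carrier f g ⟶ B :=
  coequalizer.desc h (by rw [sandwich_comp, sandwich_comp, w])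

omit [BraidedCategory M] [MonoidalClosed M] in
@[simp]
theorem π_desc (h : A ⟶ B) [IsMonHom h] (w : f ≫ h = g ≫ h) : π f g ≫ desc h w = h :=
  coequalizer.π_desc _ _

instance (h : A ⟶ B) [IsMonHom h] (w : f ≫ h = g ≫ h) : IsMonHom (desc h w) where
  one_hom := by
    rw [← IsMonHom.one_hom (π f g), Category.assoc, π_desc, IsMonHom.one_hom]
  mul_hom := by
    rw [← cancel_epi (π f g ⊗ₘ π f g), ← IsMonHom.mul_hom_assoc, π_desc, IsMonHom.mul_hom,
      tensorHom_comp_tensorHom_assoc, π_desc]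

end QuotientMonObj

/-! ### The extension along `F` and its universal property. -/

namespace PerpKan

variable {M : Type u} [Category.{w} M] [MonoidalCategory M] [SymmetricCategory M]
variable {C D : Type w} [SmallCategory C] [SmallCategory D]

/-- A family of algebra morphisms `A c ⟶ B` indexed by the morphisms `F c ⟶ d`, natural in `c`,
and such that the components at orthogonal morphisms commute. -/
structure Family (R : OrthogonalityRelation D) (F : C ⥤ D) (A : C ⥤ Mon M) (d : D)
    (B : Mon M) where
  /-- The components of the family. -/
  app : ∀ {c : C}, (F.obj c ⟶ d) → (A.obj c ⟶ B)
  naturality : ∀ {c c' : C} (h : c ⟶ c') (u : F.obj c' ⟶ d),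
    app (F.map h ≫ u) = A.map h ≫ app u
  commute : ∀ {c₁ c₂ : C} (v₁ : F.obj c₁ ⟶ d) (v₂ : F.obj c₂ ⟶ d), R.rel v₁ v₂ →
    MonObj.Commute (app v₁).hom (app v₂).hom

/-- The relations defining the universal family. -/
inductive Relation (R : OrthogonalityRelation D) (F : C ⥤ D) (d : D) : Type w
  | one (c : C) (u : F.obj c ⟶ d)
  | mul (c : C) (u : F.obj c ⟶ d)
  | nat (c c' : C) (h : c ⟶ c') (u : F.obj c' ⟶ d)
  | perp (c₁ c₂ : C) (v₁ : F.obj c₁ ⟶ d) (v₂ : F.obj c₂ ⟶ d) (h : R.rel v₁ v₂)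

variable [MonoidalClosed M] [HasColimits M]
variable (R : OrthogonalityRelation D) (F : C ⥤ D) (A : C ⥤ Mon M)

/-- The summands of the object of generators. -/
def genFamily (d : D) (i : Σ c : C, F.obj c ⟶ d) : M := (A.obj i.1).X

/-- The object of generators of the universal family. -/
def generators (d : D) : M := ∐ genFamily F A d

/-- The inclusion of the summand indexed by `u : F c ⟶ d` in the object of generators. -/
def generatorsι {d : D} {c : C} (u : F.obj c ⟶ d) : (A.obj c).X ⟶ generators F A d :=
  Sigma.ι (genFamily F A d) ⟨c, u⟩

variable {F A} in
omit [SymmetricCategory M] [MonoidalClosed M] in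
theorem generators_hom_ext {d : D} {Y : M} {f g : generators F A d ⟶ Y}
    (h : ∀ {c : C} (u : F.obj c ⟶ d), generatorsι F A u ≫ f = generatorsι F A u ≫ g) : f = g :=
  Sigma.hom_ext _ _ fun ⟨_, u⟩ => h u

variable {F A} in
/-- A morphism out of the object of generators. -/
def generatorsDesc {d : D} {Y : M} (f : ∀ (c : C), (F.obj c ⟶ d) → ((A.obj c).X ⟶ Y)) :
    generators F A d ⟶ Y :=
  Sigma.desc (f := genFamily F A d) fun i => f i.1 i.2

variable {F A} in
omit [SymmetricCategory M] [MonoidalClosed M] in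
theorem generatorsι_desc {d : D} {Y : M} (f : ∀ (c : C), (F.obj c ⟶ d) → ((A.obj c).X ⟶ Y))
    {c : C} (u : F.obj c ⟶ d) : generatorsι F A u ≫ generatorsDesc f = f c u :=
  Sigma.ι_desc (f := genFamily F A d) _ _

/-- The inclusion of the generators indexed by `u : F c ⟶ d` in the free algebra. -/
def gen {d : D} {c : C} (u : F.obj c ⟶ d) :
    (A.obj c).X ⟶ FreeMonObj.carrier (generators F A d) :=
  generatorsι F A u ≫ FreeMonObj.of (generators F A d)

variable {R} in
/-- The source of the two morphisms that a relation identifies. -/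
def Relation.source {d : D} : Relation R F d → M
  | one _ _ => 𝟙_ M
  | mul c _ => (A.obj c).X ⊗ (A.obj c).X
  | nat c _ _ _ => (A.obj c).X
  | perp c₁ c₂ _ _ _ => (A.obj c₁).X ⊗ (A.obj c₂).X

variable {R} in
/-- The left hand side of a relation. -/
def Relation.lhs {d : D} :
    ∀ r : Relation R F d, r.source F A ⟶ FreeMonObj.carrier (generators F A d)
  | one _ u => η[(A.obj _).X] ≫ gen F A u
  | mul _ u => μ[(A.obj _).X] ≫ gen F A u
  | nat _ _ h u => gen F A (F.map h ≫ u)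
  | perp _ _ v₁ v₂ _ => (gen F A v₁ ⊗ₘ gen F A v₂) ≫ μ

variable {R} in
/-- The right hand side of a relation. -/
def Relation.rhs {d : D} :
    ∀ r : Relation R F d, r.source F A ⟶ FreeMonObj.carrier (generators F A d)
  | one _ _ => η
  | mul _ u => (gen F A u ⊗ₘ gen F A u) ≫ μ
  | nat _ _ h u => (A.map h).hom ≫ gen F A u
  | perp _ _ v₁ v₂ _ => (gen F A v₁ ⊗ₘ gen F A v₂) ≫ (β_ _ _).hom ≫ μ

/-- The target of the universal family. -/
def obj (d : D) : Mon M where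
  X := QuotientMonObj.carrier (Sigma.desc (Relation.lhs (R := R) F A (d := d)))
    (Sigma.desc (Relation.rhs (R := R) F A))

/-- The projection from the free algebra on the generators to the universal algebra. -/
def proj (d : D) : FreeMonObj.carrier (generators F A d) ⟶ (obj R F A d).X :=
  QuotientMonObj.π (Sigma.desc (Relation.lhs (R := R) F A (d := d)))
    (Sigma.desc (Relation.rhs (R := R) F A))

instance (d : D) : IsMonHom (proj R F A d) :=
  inferInstanceAs (IsMonHom (QuotientMonObj.π _ _))

instance (d : D) : Epi (proj R F A d) :=
  inferInstanceAs (Epi (QuotientMonObj.π _ _))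

theorem lhs_proj {d : D} (r : Relation R F d) :
    r.lhs F A ≫ proj R F A d = r.rhs F A ≫ proj R F A d := by
  have h := Sigma.ι (Relation.source (R := R) F A (d := d)) r ≫= QuotientMonObj.condition
    (Sigma.desc (Relation.lhs (R := R) F A (d := d))) (Sigma.desc (Relation.rhs (R := R) F A))
  rwa [Sigma.ι_desc_assoc, Sigma.ι_desc_assoc] at h

variable {R F A} in
/-- The morphism out of the universal algebra induced by a morphism that respects the
relations. -/
def projDesc {d : D} {B : Mon M} (h : FreeMonObj.carrier (generators F A d) ⟶ B.X) [IsMonHom h]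
    (w : ∀ r : Relation R F d, r.lhs F A ≫ h = r.rhs F A ≫ h) : obj R F A d ⟶ B :=
  have w' : Sigma.desc (Relation.lhs (R := R) F A (d := d)) ≫ h =
      Sigma.desc (Relation.rhs (R := R) F A) ≫ h :=
    Sigma.hom_ext _ _ fun r => by rw [Sigma.ι_desc_assoc, Sigma.ι_desc_assoc, w]
  { hom := QuotientMonObj.desc h w'
    isMonHom_hom := inferInstanceAs (IsMonHom (QuotientMonObj.desc h w')) }

variable {R F A} in
@[simp]
theorem proj_projDesc {d : D} {B : Mon M} (h : FreeMonObj.carrier (generators F A d) ⟶ B.X)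
    [IsMonHom h] (w : ∀ r : Relation R F d, r.lhs F A ≫ h = r.rhs F A ≫ h) :
    proj R F A d ≫ (projDesc h w).hom = h :=
  coequalizer.π_desc _ _

/-- The universal family. -/
def universalFamily (d : D) : Family R F A d (obj R F A d) where
  app {c} u := Mon.Hom.mk' (gen F A u ≫ proj R F A d)
    (by
      rw [← Category.assoc]
      exact (lhs_proj R F A (.one c u)).trans (IsMonHom.one_hom (proj R F A d)))
    (by
      rw [← tensorHom_comp_tensorHom, Category.assoc, ← IsMonHom.mul_hom,
        ← Category.assoc, ← Category.assoc]
      exact lhs_proj R F A (.mul c u))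
  naturality {c c'} h u := by
    ext
    refine (lhs_proj R F A (.nat c c' h u)).trans ?_
    exact Category.assoc _ _ _
  commute {c₁ c₂} v₁ v₂ h := by
    have h' : ((gen F A v₁ ⊗ₘ gen F A v₂) ≫ μ) ≫ proj R F A d =
        ((gen F A v₁ ⊗ₘ gen F A v₂) ≫ (β_ _ _).hom ≫ μ) ≫ proj R F A d :=
      lhs_proj R F A (.perp c₁ c₂ v₁ v₂ h)
    simp only [Category.assoc, IsMonHom.mul_hom] at h'
    change ((gen F A v₁ ≫ proj R F A d) ⊗ₘ (gen F A v₂ ≫ proj R F A d)) ≫ _ =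
      ((gen F A v₁ ≫ proj R F A d) ⊗ₘ (gen F A v₂ ≫ proj R F A d)) ≫ _
    rw [← tensorHom_comp_tensorHom, Category.assoc, h', Category.assoc,
      BraidedCategory.braiding_naturality_assoc (proj R F A d)]

@[simp]
theorem universalFamily_app_hom {d : D} {c : C} (u : F.obj c ⟶ d) :
    ((universalFamily R F A d).app u).hom = gen F A u ≫ proj R F A d := rfl

variable {R F A}

/-- Commutation is lifted along the quotient map, reduced from words to letters, then to the
summands of the generators. -/
theorem commute_of_universalFamily {d : D} {B : Mon M} (f : obj R F A d ⟶ B) {Y : M}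
    (g : Y ⟶ B.X) (h : ∀ {c : C} (u : F.obj c ⟶ d),
      MonObj.Commute ((universalFamily R F A d).app u ≫ f).hom g) :
    MonObj.Commute f.hom g := by
  refine MonObj.Commute.of_epi_left (proj R F A d) (MonObj.Commute.free_left ?_)
  refine MonObj.Commute.sigma_left fun ⟨c, u⟩ => ?_
  change MonObj.Commute (generatorsι F A u ≫ FreeMonObj.of _ ≫ proj R F A d ≫ f.hom) g
  simpa [gen] using h u

theorem obj_hom_ext {d : D} {B : Mon M} {f g : obj R F A d ⟶ B}
    (h : ∀ {c : C} (u : F.obj c ⟶ d),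
      (universalFamily R F A d).app u ≫ f = (universalFamily R F A d).app u ≫ g) : f = g := by
  ext
  rw [← cancel_epi (proj R F A d)]
  refine FreeMonObj.monHom_ext (generators_hom_ext fun u => ?_)
  simpa [gen] using congrArg Mon.Hom.hom (h u)

/-- The morphism from the free algebra on the generators determined by a family. -/
def freeDesc {d : D} {B : Mon M} (φ : Family R F A d B) :
    FreeMonObj.carrier (generators F A d) ⟶ B.X :=
  FreeMonObj.lift (generatorsDesc fun _ u => (φ.app u).hom)

instance {d : D} {B : Mon M} (φ : Family R F A d B) : IsMonHom (freeDesc φ) :=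
  inferInstanceAs (IsMonHom (FreeMonObj.lift _))

@[simp]
theorem gen_freeDesc {d : D} {B : Mon M} (φ : Family R F A d B) {c : C} (u : F.obj c ⟶ d) :
    gen F A u ≫ freeDesc φ = (φ.app u).hom := by
  rw [gen, freeDesc, Category.assoc, FreeMonObj.of_lift, generatorsι_desc]

theorem lhs_freeDesc {d : D} {B : Mon M} (φ : Family R F A d B) (r : Relation R F d) :
    r.lhs F A ≫ freeDesc φ = r.rhs F A ≫ freeDesc φ := by
  cases r with
  | one c u =>
    change (η ≫ gen F A u) ≫ freeDesc φ = η ≫ freeDesc φ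
    simp
  | mul c u =>
    change (μ ≫ gen F A u) ≫ freeDesc φ = ((gen F A u ⊗ₘ gen F A u) ≫ μ) ≫ freeDesc φ
    simp
  | nat c c' h u =>
    change gen F A (F.map h ≫ u) ≫ freeDesc φ = ((A.map h).hom ≫ gen F A u) ≫ freeDesc φ
    simp [φ.naturality]
  | perp c₁ c₂ v₁ v₂ h =>
    change ((gen F A v₁ ⊗ₘ gen F A v₂) ≫ μ) ≫ freeDesc φ =
      ((gen F A v₁ ⊗ₘ gen F A v₂) ≫ (β_ _ _).hom ≫ μ) ≫ freeDesc φ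
    simp only [Category.assoc, IsMonHom.mul_hom]
    rw [← BraidedCategory.braiding_naturality_assoc (freeDesc φ), tensorHom_comp_tensorHom_assoc,
      tensorHom_comp_tensorHom_assoc, gen_freeDesc, gen_freeDesc]
    exact φ.commute v₁ v₂ h

/-- The morphism out of the universal algebra determined by a family. -/
def objDesc {d : D} {B : Mon M} (φ : Family R F A d B) : obj R F A d ⟶ B :=
  projDesc (freeDesc φ) (lhs_freeDesc φ)

@[simp]
theorem universalFamily_objDesc {d : D} {B : Mon M} (φ : Family R F A d B) {c : C}
    (u : F.obj c ⟶ d) : (universalFamily R F A d).app u ≫ objDesc φ = φ.app u := by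
  ext
  simp [objDesc]

@[simp]
theorem universalFamily_objDesc_assoc {d : D} {B B' : Mon M} (φ : Family R F A d B) {c : C}
    (u : F.obj c ⟶ d) (k : B ⟶ B') :
    (universalFamily R F A d).app u ≫ objDesc φ ≫ k = φ.app u ≫ k := by
  rw [← Category.assoc, universalFamily_objDesc]

/-- Precomposition of a family with a morphism. -/
@[simps]
def Family.restrict {d d' : D} {B : Mon M} (φ : Family R F A d' B) (k : d ⟶ d') :
    Family R F A d B where
  app u := φ.app (u ≫ k)
  naturality h u := by rw [Category.assoc, φ.naturality]
  commute v₁ v₂ h := φ.commute _ _ (by simpa using R.comp_stable k v₁ v₂ (𝟙 _) (𝟙 _) h)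

variable (R F A)

/-- The left Kan extension of `A` along `F` in the sense of `⊥`-commutative functors. -/
@[simps]
def extension : D ⥤ Mon M where
  obj := obj R F A
  map {d d'} k := objDesc ((universalFamily R F A d').restrict k)
  map_id d := obj_hom_ext fun u => by simp
  map_comp k l := obj_hom_ext fun u => by simp

/-- On generators the two maps become the components at `u₁ ≫ f₁` and `u₂ ≫ f₂`, which are
orthogonal by stability. -/
theorem extension_isPerpCommutative : IsPerpCommutative M R (extension R F A) := by
  intro d₁ d₂ d f₁ f₂ h
  refine commute_of_universalFamily _ _ fun u₁ => MonObj.Commute.symm ?_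
  refine commute_of_universalFamily _ _ fun u₂ => MonObj.Commute.symm ?_
  change MonObj.Commute
    ((universalFamily R F A d₁).app u₁ ≫ objDesc ((universalFamily R F A d).restrict f₁)).hom
    ((universalFamily R F A d₂).app u₂ ≫ objDesc ((universalFamily R F A d).restrict f₂)).hom
  rw [universalFamily_objDesc, universalFamily_objDesc]
  refine (universalFamily R F A d).commute _ _ ?_
  simpa using R.comp_stable (𝟙 d) f₁ f₂ u₁ u₂ h

/-- The unit of the extension. -/
@[simps]
def extensionUnit : A ⟶ F ⋙ extension R F A where
  app c := (universalFamily R F A (F.obj c)).app (𝟙 _)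
  naturality c c' h := by
    change A.map h ≫ (universalFamily R F A (F.obj c')).app (𝟙 _) =
      (universalFamily R F A (F.obj c)).app (𝟙 _) ≫
        objDesc ((universalFamily R F A (F.obj c')).restrict (F.map h))
    rw [universalFamily_objDesc, ← (universalFamily R F A (F.obj c')).naturality]
    simp

variable {R F A}

/-- The family determined by a natural transformation to the restriction of a
`⊥`-commutative functor. -/
@[simps]
def Family.ofNatTrans {B : D ⥤ Mon M} (hB : IsPerpCommutative M R B) (α : A ⟶ F ⋙ B) (d : D) :
    Family R F A d (B.obj d) where
  app {c} u := α.app c ≫ B.map u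
  naturality h u := by simp
  commute v₁ v₂ h :=
    (((show MonObj.Commute _ _ from hB v₁ v₂ h).comp_left _).symm.comp_left _).symm

/-- The universal property of the extension. -/
def extensionHomEquiv {B : D ⥤ Mon M} (hB : IsPerpCommutative M R B) :
    (extension R F A ⟶ B) ≃ (A ⟶ F ⋙ B) where
  toFun β := extensionUnit R F A ≫ Functor.whiskerLeft F β
  invFun α :=
    { app d := objDesc (Family.ofNatTrans hB α d)
      naturality d d' k := obj_hom_ext fun u => by
        change (universalFamily R F A d).app u ≫ objDesc ((universalFamily R F A d').restrict k) ≫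
          objDesc (Family.ofNatTrans hB α d') =
            (universalFamily R F A d).app u ≫ objDesc (Family.ofNatTrans hB α d) ≫ B.map k
        simp }
  left_inv β := by
    ext1; ext1 d
    refine obj_hom_ext fun {c} u => ?_
    let b (d : D) : obj R F A d ⟶ B.obj d := β.app d
    -- Naturality of `β` at `u` itself recovers the component at `u` from the one at the identity of
    -- `F c`.
    have h : objDesc ((universalFamily R F A d).restrict u) ≫ b d = b (F.obj c) ≫ B.map u :=
      β.naturality u
    change (universalFamily R F A d).app u ≫ objDesc _ = (universalFamily R F A d).app u ≫ b d
    rw [universalFamily_objDesc]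
    change ((universalFamily R F A (F.obj c)).app (𝟙 _) ≫ b (F.obj c)) ≫ B.map u = _
    rw [Category.assoc, ← h, universalFamily_objDesc_assoc, Family.restrict_app,
      Category.id_comp]
  right_inv α := by
    ext1; ext1 c
    change (universalFamily R F A (F.obj c)).app (𝟙 _) ≫ objDesc _ = _
    rw [universalFamily_objDesc]
    simp

end PerpKan

theorem theorem2p8 (M : Type u) [Category.{w} M] [MonoidalCategory M] [SymmetricCategory M]
    [MonoidalClosed M] [HasLimits M] [HasColimits M]
    {C D : Type w} [SmallCategory C] [SmallCategory D]
    (RC : OrthogonalityRelation C) (RD : OrthogonalityRelation D)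
    (F : OrthogonalFunctor RC RD) :
    ∃ F_shriek : QFT M RC ⥤ QFT M RD, Nonempty (F_shriek ⊣ pullbackQFT M F) := by
  let L (A : QFT M RC) : QFT M RD := ⟨PerpKan.extension RD F.toFunctor A.obj,
    PerpKan.extension_isPerpCommutative RD F.toFunctor A.obj⟩
  let e (A : QFT M RC) (B : QFT M RD) : (L A ⟶ B) ≃ (A ⟶ (pullbackQFT M F).obj B) :=
    (ObjectProperty.fullyFaithfulι _).homEquiv.trans
      ((PerpKan.extensionHomEquiv (F := F.toFunctor) (A := A.obj) B.property).trans
        ((ObjectProperty.fullyFaithfulι (IsPerpCommutative M RC)).homEquiv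
          (X := A) (Y := (pullbackQFT M F).obj B)).symm)
  -- Naturality in `B` suffices: the action of the left adjoint on morphisms of `A` is then forced
  -- by the bijections.
  have he : ∀ A B B' (g : B ⟶ B') (h : L A ⟶ B),
      e A B' (h ≫ g) = e A B h ≫ (pullbackQFT M F).map g := by
    intro A B B' g h
    apply ObjectProperty.hom_ext
    change PerpKan.extensionUnit RD F.toFunctor A.obj ≫
        Functor.whiskerLeft F.toFunctor (h.hom ≫ g.hom) =
      (PerpKan.extensionUnit RD F.toFunctor A.obj ≫ Functor.whiskerLeft F.toFunctor h.hom) ≫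
        Functor.whiskerLeft F.toFunctor g.hom
    rw [Functor.whiskerLeft_comp, Category.assoc]
  exact ⟨_, ⟨Adjunction.adjunctionOfEquivLeft e he⟩⟩
end
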